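/- **Theorem 2 (Liveness).** The state consists of real numbers $A,B,T,\varepsilon$ (parameters), $x,y$ (waypoint relative to the robot), $v_l,v_h$ (speed limits), $k$ (curvature), $v$ (speed), $a$ (acceleration) and $t$ (clock). Write $\|(x,y)\|=\sqrt{x^2+y^2}$, $\|(x,y)\|_\infty=\max(|x|,|y|)$ and $\kappa=(1+|k|\varepsilon)^2$, and define - $\mathsf{Ann}$: $|k|\varepsilon\le 1$ and $\bigl|\tfrac{k(x^2+y^2-\varepsilon^2)}{2}-y\bigr|<\varepsilon$; - $L$: $0\le v_l<v_h$, $AT\le v_h-v_l$ and $BT\le v_h-v_l$; - $\mathsf{Feas}$: $\mathsf{Ann}$, $x>0$ and $L$; - $\mathsf{Go}$: $-B\le a\le A$ and $v+aT\ge 0$; and [$v\le v_h$ and $v+aT\le v_h$, or $\kappa\bigl(vT+\tfrac a2T^2+\tfrac{(v+aT)^2-v_h^2}{2B}\bigr)+\varepsilon\le\|(x,y)\|_\infty$]; and [$v_l\le v$ and $v_l\le v+aT$, or $\kappa\bigl(vT+\tfrac a2T^2+\tfrac{v_l^2-(v+aT)^2}{2A}\bigr)+\varepsilon\le\|(x,y)\|_\infty$];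 - $J$: $\mathsf{Ann}$ and $L$; and [$v_l\le v$ or $\kappa\tfrac{v_l^2-v^2}{2A}+\varepsilon\le\|(x,y)\|_\infty$]; and [$v\le v_h$ or $\kappa\tfrac{v^2-v_h^2}{2B}+\varepsilon\le\|(x,y)\|_\infty$]. The program $\mathsf{ctrl}_a$ assigns an arbitrary real number to $a$ and requires that $\mathsf{Go}$ then holds. The program $\mathsf{ctrl}$ assigns arbitrary real numbers to $x,y,v_l,v_h,k$, requires that $\mathsf{Feas}$ then holds, and then runs $\mathsf{ctrl}_a$. The program $\mathsf{plant}$ sets $t:=0$ and then follows, for an arbitrary duration $\ge 0$, a solution of $x'=v(ky-1)$, $y'=-vkx$, $v'=a$, $t'=1$ (all other variables constant) along which $t\le T$ and $v\ge 0$ hold throughout. A star denotes repetition any finite number ($\ge 0$) of times. Then the formula of differential dynamic logic $$A>0\land B>0\land T>0\land\varepsilon>0\land J\;\to\;[(\mathsf{ctrl};\mathsf{plant})^*]\Bigl(v>0\land x>0\;\to\;\langle(\mathsf{ctrl}_a;\mathsf{plant})^*\rangle\bigl(\|(x,y)\|\le\varepsilon\land v_l\le v\le v_h\bigr)\Bigr)$$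 is valid. That is: from every state with $A,B,T,\varepsilon>0$ and $J$, in every state reached by some run of $(\mathsf{ctrl};\mathsf{plant})^*$, if $v>0$ and $x>0$ then some run of $(\mathsf{ctrl}_a;\mathsf{plant})^*$ from that state ends in a state with $\|(x,y)\|\le\varepsilon$ and $v\in[v_l,v_h]$. -/

import Mathlib

namespace Waypoint

/-! ### Hybrid programs and the modalities of differential dynamic logic -/

/-- The variables of the ground robot model. The acceleration bound `A`, braking bound `B`,
cycle time `T` and tolerance `eps` are symbolic parameters: no program below writes to them.
`x`, `y` is the waypoint in robot-relative coordinates, `vl`, `vh` are the speed limits,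
`k` is the curvature, `v` the speed, `a` the acceleration and `t` the clock. -/
inductive Var
  | A | B | T | eps | x | y | vl | vh | k | v | a | t
  deriving DecidableEq

/-- A state assigns a real number to every variable. -/
abbrev State := Var → ℝ

/-- Terms are identified with their value in each state. -/
abbrev Term := State → ℝ

/-- Formulas are identified with the set of states in which they hold. -/
abbrev Formula := State → Prop

/-- Hybrid programs. -/
inductive HP
  /-- `?φ` -/
  | test (φ : Formula)
  /-- `z := θ` -/
  | assign (z : Var) (θ : Term)
  /-- `z := *` -/
  | random (z : Var)
  /-- `{x₁' = θ₁, …, xₙ' = θₙ & ψ}` -/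
  | ode (eqs : List (Var × Term)) (ψ : Formula)
  /-- `α ; β` -/
  | seq (α β : HP)
  /-- `α ∪ β` -/
  | choice (α β : HP)
  /-- `α*` -/
  | star (α : HP)

/-- `FollowsODE eqs ψ r φ`: on the time interval `[0, r]` the curve `φ` of states solves the
differential equations `eqs` (with one-sided derivatives at the end points), keeps all variables
without an equation constant, and stays within the domain constraint `ψ`. -/
def FollowsODE (eqs : List (Var × Term)) (ψ : Formula) (r : ℝ) (φ : ℝ → State) : Prop :=
  ∀ τ ∈ Set.Icc 0 r,
    (∀ e ∈ eqs, HasDerivWithinAt (fun u => φ u e.1) (e.2 (φ τ)) (Set.Icc 0 r) τ) ∧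
    (∀ z : Var, z ∉ eqs.map Prod.fst → φ τ z = φ 0 z) ∧
    ψ (φ τ)

/-- Transition semantics: `α.Run s s'` means that some run of `α` started in the state `s`
ends in the state `s'`. -/
def HP.Run : HP → State → State → Prop
  | .test φ, s, s' => s' = s ∧ φ s
  | .assign z θ, s, s' => s' = Function.update s z (θ s)
  | .random z, s, s' => ∃ c : ℝ, s' = Function.update s z c
  | .ode eqs ψ, s, s' =>
      ∃ r : ℝ, 0 ≤ r ∧ ∃ φ : ℝ → State, φ 0 = s ∧ φ r = s' ∧ FollowsODE eqs ψ r φ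
  | .seq α β, s, s' => ∃ u, α.Run s u ∧ β.Run u s'
  | .choice α β, s, s' => α.Run s s' ∨ β.Run s s'
  | .star α, s, s' => Relation.ReflTransGen α.Run s s'

/-- The formula `[α]φ`: `φ` holds after all runs of `α`. -/
def box (α : HP) (φ : Formula) : Formula := fun s => ∀ s', α.Run s s' → φ s'

/-- The formula `⟨α⟩φ`: `φ` holds after some run of `α`. -/
def diamond (α : HP) (φ : Formula) : Formula := fun s => ∃ s', α.Run s s' ∧ φ s'

/-- A formula is valid if it holds in all states. -/
def Valid (φ : Formula) : Prop := ∀ s, φ s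

/-! ### The ground robot model -/

/-- Maximum norm of the waypoint position. -/
noncomputable def maxNorm : Term := fun s => max |s .x| |s .y|

/-- Euclidean norm of the waypoint position. -/
noncomputable def euclNorm : Term := fun s => √((s .x) ^ 2 + (s .y) ^ 2)

/-- The robot is inside the annular section of width `eps` that ends at the waypoint. -/
def Ann : Formula := fun s =>
  |s .k| * s .eps ≤ 1 ∧
  |s .k * ((s .x) ^ 2 + (s .y) ^ 2 - (s .eps) ^ 2) / 2 - s .y| < s .eps

/-- The speed limits are nonnegative, distinct and not crossed within one control cycle. -/
def LimitsOk : Formula := fun s =>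
  0 ≤ s .vl ∧ s .vl < s .vh ∧ s .A * s .T ≤ s .vh - s .vl ∧ s .B * s .T ≤ s .vh - s .vl

/-- Feasibility of the waypoint, the speed limits and the curvature. -/
def Feas : Formula := fun s => Ann s ∧ 0 < s .x ∧ LimitsOk s

/-- Admissibility of the acceleration `a`. -/
def Go : Formula := fun s =>
  (-(s .B) ≤ s .a ∧ s .a ≤ s .A ∧ 0 ≤ s .v + s .a * s .T) ∧
  ((s .v ≤ s .vh ∧ s .v + s .a * s .T ≤ s .vh) ∨
    (1 + |s .k| * s .eps) ^ 2 *
      (s .v * s .T + s .a / 2 * (s .T) ^ 2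
        + ((s .v + s .a * s .T) ^ 2 - (s .vh) ^ 2) / (2 * s .B)) + s .eps ≤ maxNorm s) ∧
  ((s .vl ≤ s .v ∧ s .vl ≤ s .v + s .a * s .T) ∨
    (1 + |s .k| * s .eps) ^ 2 *
      (s .v * s .T + s .a / 2 * (s .T) ^ 2
        + ((s .vl) ^ 2 - (s .v + s .a * s .T) ^ 2) / (2 * s .A)) + s .eps ≤ maxNorm s)

/-- `ctrlA ≡ a := *; ?Go`: choice of an admissible acceleration. -/
def ctrlA : HP := .seq (.random .a) (.test Go)

/-- `ctrl ≡ (x,y) := *; [vl,vh] := *; k := *; ?Feas; a := *; ?Go` -/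
def ctrl : HP :=
  .seq (.random .x) <| .seq (.random .y) <| .seq (.random .vl) <| .seq (.random .vh) <|
    .seq (.random .k) <| .seq (.test Feas) ctrlA

/-- `plant ≡ t := 0; {x' = v (k y - 1), y' = -v k x, v' = a, t' = 1 & t ≤ T ∧ v ≥ 0}` -/
def plant : HP :=
  .seq (.assign .t fun _ => 0)
    (.ode
      [(.x, fun s => s .v * (s .k * s .y - 1)),
       (.y, fun s => -(s .v) * s .k * s .x),
       (.v, fun s => s .a),
       (.t, fun _ => 1)]
      (fun s => s .t ≤ s .T ∧ 0 ≤ s .v))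

/-- `Lim v₁ v₂ a`: the acceleration `a` can close the speed gap `v₁ - v₂` before the waypoint
reaches the robot. -/
def Lim (v₁ v₂ a : Term) : Formula := fun s =>
  v₁ s ≤ v₂ s ∨
  (1 + |s .k| * s .eps) ^ 2 * (((v₁ s) ^ 2 - (v₂ s) ^ 2) / (2 * a s)) + s .eps ≤ maxNorm s

/-- The loop invariant `J`, which is assumed to hold initially. -/
def J : Formula := fun s =>
  Ann s ∧ LimitsOk s ∧
  Lim (fun s => s .vl) (fun s => s .v) (fun s => s .A) s ∧
  Lim (fun s => s .v) (fun s => s .vh) (fun s => s .B) s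

/-- The robot is at the goal and obeys the speed limits. -/
def AtGoal : Formula := fun s => euclNorm s ≤ s .eps ∧ s .v ∈ Set.Icc (s .vl) (s .vh)

end Waypoint

namespace Waypoint

open Set

/-! ### Every run of the plant -/

/-! The plant preserves `k(x² + y² - ε²)/2 - y`, hence `Ann`, so `|k|` times the distance to the
centre of rotation is at most `K = 1 + |k|ε`. Each coordinate then moves at speed at most `K v`, and
the max norm drops by at most `K` times the distance travelled. The factor `K²` in `Go` and `Lim`
absorbs this drop, which makes `J` invariant (`plant_run`, `gap_le_of_le`).

For the diamond, `J` makes full acceleration or full braking admissible until the speed is within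
its limits; after that, acceleration 0 stays admissible. If `k ≠ 0`, the waypoint circles forever
relative to the robot and `Ann` places a point of the circle within `ε` of the origin. If `k = 0`,
the waypoint must not be passed while the speed is corrected, which `Ready.gap_lt` ensures. -/

/-- A function with nonnegative one-sided derivative on `[0, r]` lies above its initial value. -/
theorem le_of_hasDerivWithinAt_nonneg {f f' : ℝ → ℝ} {r : ℝ}
    (hf : ∀ τ ∈ Icc 0 r, HasDerivWithinAt f (f' τ) (Icc 0 r) τ)
    (hf' : ∀ τ ∈ Icc 0 r, 0 ≤ f' τ) {τ : ℝ} (hτ : τ ∈ Icc 0 r) : f 0 ≤ f τ :=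
  monotoneOn_of_hasDerivWithinAt_nonneg (convex_Icc 0 r)
    (fun u hu => (hf u hu).continuousWithinAt)
    (fun u hu => (hf u (interior_subset hu)).mono interior_subset)
    (fun u hu => hf' u (interior_subset hu)) ⟨le_rfl, hτ.1.trans hτ.2⟩ hτ hτ.1

/-- A function with zero one-sided derivative on `[0, r]` is constant. -/
theorem eq_of_hasDerivWithinAt_zero {f f' : ℝ → ℝ} {r : ℝ}
    (hf : ∀ τ ∈ Icc 0 r, HasDerivWithinAt f (f' τ) (Icc 0 r) τ)
    (hf' : ∀ τ ∈ Icc 0 r, f' τ = 0) {τ : ℝ} (hτ : τ ∈ Icc 0 r) : f τ = f 0 := by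
  have h₁ := le_of_hasDerivWithinAt_nonneg hf (fun u hu => (hf' u hu).ge) hτ
  have h₂ := le_of_hasDerivWithinAt_nonneg (fun u hu => (hf u hu).neg)
    (fun u hu => by simp [hf' u hu]) hτ
  simp only [Pi.neg_apply] at h₂
  linarith

/-- A curve moving with speed at most `K * d'` moves no further than `K * d`. -/
theorem abs_le_abs_add_of_abs_deriv_le {f f' d d' : ℝ → ℝ} {r K : ℝ}
    (hf : ∀ τ ∈ Icc 0 r, HasDerivWithinAt f (f' τ) (Icc 0 r) τ)
    (hd : ∀ τ ∈ Icc 0 r, HasDerivWithinAt d (d' τ) (Icc 0 r) τ) (hd0 : d 0 = 0)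
    (h : ∀ τ ∈ Icc 0 r, |f' τ| ≤ K * d' τ) {τ : ℝ} (hτ : τ ∈ Icc 0 r) :
    |f 0| ≤ |f τ| + K * d τ := by
  have h₁ := le_of_hasDerivWithinAt_nonneg
    (fun u hu => ((hd u hu).const_mul K).add (hf u hu))
    (fun u hu => by linarith [neg_abs_le (f' u), h u hu]) hτ
  have h₂ := le_of_hasDerivWithinAt_nonneg
    (fun u hu => ((hd u hu).const_mul K).sub (hf u hu))
    (fun u hu => by linarith [le_abs_self (f' u), h u hu]) hτ
  simp only [Pi.add_apply, Pi.sub_apply, hd0] at h₁ h₂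
  exact abs_le.2 ⟨by linarith [neg_abs_le (f τ)], by linarith [le_abs_self (f τ)]⟩

/-- The squared distance to the centre of rotation, in units of the radius `1 / |k|`. -/
theorem sq_add_sq_eq (k e x y : ℝ) :
    (k * x) ^ 2 + (k * y - 1) ^ 2
      = 1 + (k * e) ^ 2 + 2 * (k * (k * (x ^ 2 + y ^ 2 - e ^ 2) / 2 - y)) := by
  ring

/-- The distance to the centre of rotation is at most `(1 + |k| ε) / |k|`. -/
theorem Ann.sq_add_sq_le {s : State} (h : Ann s) :
    (s .k * s .x) ^ 2 + (s .k * s .y - 1) ^ 2 ≤ (1 + |s .k| * s .eps) ^ 2 := by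
  rw [sq_add_sq_eq _ (s .eps)]
  have h₁ := (le_abs_self _).trans
    ((abs_mul (s .k) _).trans_le (mul_le_mul_of_nonneg_left h.2.le (abs_nonneg (s .k))))
  nlinarith [sq_abs (s .k)]

/-- A summary of the runs of the plant. -/
theorem plant_run {s s' : State} (h : plant.Run s s') (hs : Ann s) (he : 0 < s .eps) :
    ∃ r, 0 ≤ r ∧ r ≤ s .T ∧ (∀ z, z ≠ .x → z ≠ .y → z ≠ .v → z ≠ .t → s' z = s z) ∧
      s' .v = s .v + s .a * r ∧ 0 ≤ s .v ∧ 0 ≤ s' .v ∧ Ann s' ∧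
      maxNorm s ≤ maxNorm s' +
        (1 + |s .k| * s .eps) * (s .v * r + s .a / 2 * r ^ 2) := by
  obtain ⟨_, rfl, r, hr, φ, h0, rfl, hφ⟩ := h
  have hr0 : (0 : ℝ) ∈ Icc 0 r := ⟨le_rfl, hr⟩
  have hrr : r ∈ Icc 0 r := ⟨hr, le_rfl⟩
  have hx0 : φ 0 .x = s .x := by simp [h0]
  have hy0 : φ 0 .y = s .y := by simp [h0]
  have hv0 : φ 0 .v = s .v := by simp [h0]
  have ht0 : φ 0 .t = 0 := by simp [h0]
  have hc : ∀ z, z ≠ .x → z ≠ .y → z ≠ .v → z ≠ .t → ∀ τ ∈ Icc 0 r, φ τ z = s z := by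
    intro z hx hy hv ht τ hτ
    rw [(hφ τ hτ).2.1 z (by simp [hx, hy, hv, ht]), h0]
    simp [ht]
  have hk := hc .k (by simp) (by simp) (by simp) (by simp)
  have ha := hc .a (by simp) (by simp) (by simp) (by simp)
  have hT := hc .T (by simp) (by simp) (by simp) (by simp)
  have heps := hc .eps (by simp) (by simp) (by simp) (by simp)
  have dx : ∀ τ ∈ Icc 0 r, HasDerivWithinAt (fun u => φ u .x)
      (φ τ .v * (s .k * φ τ .y - 1)) (Icc 0 r) τ := fun τ hτ => by
    simpa [hk τ hτ] using (hφ τ hτ).1 (.x, fun s => s .v * (s .k * s .y - 1)) (by simp)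
  have dy : ∀ τ ∈ Icc 0 r, HasDerivWithinAt (fun u => φ u .y)
      (-(φ τ .v) * s .k * φ τ .x) (Icc 0 r) τ := fun τ hτ => by
    simpa [hk τ hτ] using (hφ τ hτ).1 (.y, fun s => -(s .v) * s .k * s .x) (by simp)
  have dv : ∀ τ ∈ Icc 0 r, HasDerivWithinAt (fun u => φ u .v) (s .a) (Icc 0 r) τ :=
    fun τ hτ => by simpa [ha τ hτ] using (hφ τ hτ).1 (.v, fun s => s .a) (by simp)
  have dt : ∀ τ ∈ Icc 0 r, HasDerivWithinAt (fun u => φ u .t) 1 (Icc 0 r) τ :=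
    fun τ hτ => (hφ τ hτ).1 (.t, fun _ => 1) (by simp)
  have hv : ∀ τ ∈ Icc 0 r, φ τ .v = s .v + s .a * τ := fun τ hτ => by
    have := eq_of_hasDerivWithinAt_zero
      (fun u hu => (dv u hu).sub (((hasDerivAt_id u).const_mul (s .a)).hasDerivWithinAt))
      (fun u _ => by simp) hτ
    simp [hv0] at this
    linarith
  have ht : φ r .t = r := by
    have := eq_of_hasDerivWithinAt_zero
      (fun u hu => (dt u hu).sub ((hasDerivAt_id u).hasDerivWithinAt)) (fun u _ => by simp) hrr
    simp [ht0] at this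
    linarith
  have hcirc : ∀ τ ∈ Icc 0 r,
      s .k * (φ τ .x ^ 2 + φ τ .y ^ 2 - s .eps ^ 2) / 2 - φ τ .y
        = s .k * (s .x ^ 2 + s .y ^ 2 - s .eps ^ 2) / 2 - s .y := fun τ hτ => by
    have := eq_of_hasDerivWithinAt_zero
      (fun u hu => (((((dx u hu).pow 2).add ((dy u hu).pow 2)).const_mul (s .k / 2)).sub
        (dy u hu))) (fun u _ => by push_cast; ring) hτ
    simp only [Pi.sub_apply, Pi.add_apply, Pi.pow_apply, hx0, hy0] at this
    linarith
  have hAnn : ∀ τ ∈ Icc 0 r, Ann (φ τ) := fun τ hτ => by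
    unfold Ann
    rw [hk τ hτ, heps τ hτ, hcirc τ hτ]
    exact hs
  have hnn : ∀ τ ∈ Icc 0 r, 0 ≤ φ τ .v := fun τ hτ => (hφ τ hτ).2.2.2
  have hK : 0 ≤ 1 + |s .k| * s .eps := by positivity
  have dd : ∀ τ ∈ Icc 0 r, HasDerivWithinAt (fun u => s .v * u + s .a / 2 * u ^ 2)
      (φ τ .v) (Icc 0 r) τ := fun τ hτ => by
    refine ((((hasDerivAt_id τ).const_mul (s .v)).add
      (((hasDerivAt_id τ).pow 2).const_mul (s .a / 2))).congr_deriv ?_).hasDerivWithinAt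
    rw [hv τ hτ]; simp; ring
  have hle : ∀ τ ∈ Icc 0 r, |s .k * φ τ .y - 1| ≤ 1 + |s .k| * s .eps ∧
      |s .k * φ τ .x| ≤ 1 + |s .k| * s .eps := fun τ hτ => by
    have := (hAnn τ hτ).sq_add_sq_le
    rw [hk τ hτ, heps τ hτ] at this
    exact ⟨abs_le_of_sq_le_sq (by nlinarith [sq_nonneg (s .k * φ τ .x)]) hK,
      abs_le_of_sq_le_sq (by nlinarith [sq_nonneg (s .k * φ τ .y - 1)]) hK⟩
  have hX := abs_le_abs_add_of_abs_deriv_le (K := 1 + |s .k| * s .eps) dx dd (by simp)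
    (fun τ hτ => by
      rw [abs_mul, abs_of_nonneg (hnn τ hτ), mul_comm]
      exact mul_le_mul_of_nonneg_right (hle τ hτ).1 (hnn τ hτ)) hrr
  have hY := abs_le_abs_add_of_abs_deriv_le (K := 1 + |s .k| * s .eps) dy dd (by simp)
    (fun τ hτ => by
      rw [mul_assoc, abs_mul, abs_neg, abs_of_nonneg (hnn τ hτ), mul_comm]
      exact mul_le_mul_of_nonneg_right (hle τ hτ).2 (hnn τ hτ)) hrr
  refine ⟨r, hr, ?_, fun z h₁ h₂ h₃ h₄ => hc z h₁ h₂ h₃ h₄ r hrr, hv r hrr, hv0 ▸ hnn 0 hr0,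
    hnn r hrr, hAnn r hrr, ?_⟩
  · have := (hφ r hrr).2.2.1
    rwa [ht, hT r hrr] at this
  · simp only [hx0, hy0] at hX hY
    exact max_le (hX.trans (by gcongr; exact le_max_left _ _))
      (hY.trans (by gcongr; exact le_max_right _ _))

/-! ### Invariance of `J` -/

/-- The parameters are positive. -/
def ParamsPos (s : State) : Prop := 0 < s .A ∧ 0 < s .B ∧ 0 < s .T ∧ 0 < s .eps

/-- If the distance left at the end of a control cycle suffices to close the speed gap, then so does
the distance left at every earlier time. -/
theorem gap_le_of_le {K v a T r D m m' e q : ℝ} (hK : 1 ≤ K) (hr : 0 ≤ r) (hrT : r ≤ T)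
    (hv : 0 ≤ v) (hvT : 0 ≤ v + a * T) (hq : 0 ≤ 1 + a * q)
    (h : K ^ 2 * (v * T + a / 2 * T ^ 2 + q * ((v + a * T) ^ 2 - D) / 2) + e ≤ m)
    (hm : m ≤ m' + K * (v * r + a / 2 * r ^ 2)) :
    K ^ 2 * (q * ((v + a * r) ^ 2 - D) / 2) + e ≤ m' := by
  have hvr : 0 ≤ v + a * r := by
    rcases le_total 0 a with ha | ha
    · positivity
    · nlinarith
  have hd : 0 ≤ v * r + a / 2 * r ^ 2 := by nlinarith
  have hdT : 0 ≤ (T - r) * ((v + a * r) + (v + a * T)) / 2 := by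
    have := sub_nonneg.2 hrT
    positivity
  -- The difference is exactly `(1 + a * q)` times the distance covered between `r` and `T`, because
  -- `(v + aT)² - (v + ar)²` is `2a` times that distance.
  have hmono : 0 ≤ (v * T + a / 2 * T ^ 2 + q * ((v + a * T) ^ 2 - D) / 2)
      - (v * r + a / 2 * r ^ 2 + q * ((v + a * r) ^ 2 - D) / 2) := by
    have := mul_nonneg hdT hq
    linarith
  have h₁ := mul_nonneg (sq_nonneg K) hmono
  have h₂ : K * (v * r + a / 2 * r ^ 2) ≤ K ^ 2 * (v * r + a / 2 * r ^ 2) :=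
    mul_le_mul_of_nonneg_right (by nlinarith) hd
  linarith

/-- `J` holds at every time of a control cycle with an admissible acceleration. -/
theorem J_of_plant_run {s s' : State} (hp : ParamsPos s) (hA : Ann s) (hL : LimitsOk s)
    (hG : Go s) (h : plant.Run s s') : J s' ∧ ParamsPos s' := by
  obtain ⟨hApos, hBpos, hTpos, hepos⟩ := hp
  obtain ⟨r, hr, hrT, hc, hv, hv0, hv', hA', hm⟩ := plant_run h hA hepos
  have cA := hc .A (by simp) (by simp) (by simp) (by simp)
  have cB := hc .B (by simp) (by simp) (by simp) (by simp)
  have cT := hc .T (by simp) (by simp) (by simp) (by simp)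
  have ce := hc .eps (by simp) (by simp) (by simp) (by simp)
  have ck := hc .k (by simp) (by simp) (by simp) (by simp)
  have cl := hc .vl (by simp) (by simp) (by simp) (by simp)
  have ch := hc .vh (by simp) (by simp) (by simp) (by simp)
  obtain ⟨⟨haB, haA, hvT⟩, hhi, hlo⟩ := hG
  have hK : 1 ≤ 1 + |s .k| * s .eps := by
    have : 0 ≤ |s .k| * s .eps := by positivity
    linarith
  refine ⟨⟨hA', ?_, ?_, ?_⟩, ?_⟩
  · simpa only [LimitsOk, cA, cB, cT, cl, ch] using hL
  · simp only [Lim, ck, ce, cl, cA, hv]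
    rcases hlo with ⟨h₁, h₂⟩ | h₁
    · left
      rcases le_total 0 (s .a) with ha | ha <;> nlinarith
    · right
      -- With `q = -1/A` this is `a ≤ A`; for the upper limit below, `q = 1/B` turns it into `-B ≤
      -- a`.
      have hq : 0 ≤ 1 + s .a * -(s .A)⁻¹ := by
        have : s .a * (s .A)⁻¹ ≤ 1 := by
          rw [← div_eq_mul_inv, div_le_one hApos]; exact haA
        linarith
      have := gap_le_of_le (D := s .vl ^ 2) (e := s .eps) hK hr hrT hv0 hvT hq
        (by refine le_trans (le_of_eq ?_) h₁; field_simp; ring) hm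
      refine le_trans (le_of_eq ?_) this
      field_simp; ring
  · simp only [Lim, ck, ce, ch, cB, hv]
    rcases hhi with ⟨h₁, h₂⟩ | h₁
    · left
      rcases le_total 0 (s .a) with ha | ha <;> nlinarith
    · right
      have hq : 0 ≤ 1 + s .a * (s .B)⁻¹ := by
        have : -1 ≤ s .a * (s .B)⁻¹ := by
          rw [← div_eq_mul_inv, le_div_iff₀ hBpos]; linarith
        linarith
      have := gap_le_of_le (D := s .vh ^ 2) (e := s .eps) hK hr hrT hv0 hvT hq
        (by refine le_trans (le_of_eq ?_) h₁; field_simp) hm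
      refine le_trans (le_of_eq ?_) this
      field_simp
  · simpa only [ParamsPos, cA, cB, cT, ce] using ⟨hApos, hBpos, hTpos, hepos⟩

/-- `J` is an invariant of the loop of controller and plant. -/
theorem J_of_loop_run {s s' : State} (hp : ParamsPos s) (hJ : J s)
    (h : (HP.star (.seq ctrl plant)).Run s s') : J s' ∧ ParamsPos s' := by
  change Relation.ReflTransGen _ s s' at h
  induction h with
  | refl => exact ⟨hJ, hp⟩
  | tail _ hstep ih =>
    obtain ⟨u, hctrl, hplant⟩ := hstep
    obtain ⟨_, ⟨x, rfl⟩, _, ⟨y, rfl⟩, _, ⟨vl, rfl⟩, _, ⟨vh, rfl⟩, _, ⟨k, rfl⟩, _, ⟨rfl, hF⟩,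
      _, ⟨a, rfl⟩, ⟨rfl, hG⟩⟩ := hctrl
    obtain ⟨hA, -, hL⟩ := hF
    -- `J` is rebuilt in each iteration: `Feas` supplies `Ann` and the limits, `Go` the two `Lim`
    -- conditions.
    refine J_of_plant_run ?_ ?_ ?_ hG hplant
    · simpa [ParamsPos] using ih.2
    · simpa [Ann] using hA
    · simpa [LimitsOk] using hL

/-! ### Existence of runs -/

/-- First coordinate of the waypoint after the robot has travelled the distance `d`. -/
noncomputable def flowX (k x y d : ℝ) : ℝ :=
  if k = 0 then x - d else x * Real.cos (k * d) + (y - 1 / k) * Real.sin (k * d)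

/-- Second coordinate of the waypoint after the robot has travelled the distance `d`. -/
noncomputable def flowY (k x y d : ℝ) : ℝ :=
  if k = 0 then y else 1 / k - x * Real.sin (k * d) + (y - 1 / k) * Real.cos (k * d)

theorem flowX_zero (k x y : ℝ) : flowX k x y 0 = x := by simp [flowX]

theorem flowY_zero (k x y : ℝ) : flowY k x y 0 = y := by simp [flowY]

/-- Angle addition for the rotation about `(0, 1/k)`; it lets a trip be cut into control cycles. -/
theorem flowX_add (k x y d d' : ℝ) :
    flowX k (flowX k x y d) (flowY k x y d) d' = flowX k x y (d + d') := by
  unfold flowX flowY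
  split_ifs
  · ring
  · rw [mul_add, Real.cos_add, Real.sin_add]; ring

theorem flowY_add (k x y d d' : ℝ) :
    flowY k (flowX k x y d) (flowY k x y d) d' = flowY k x y (d + d') := by
  unfold flowX flowY
  split_ifs
  · ring
  · rw [mul_add, Real.cos_add, Real.sin_add]; ring

theorem hasDerivAt_flowX (k x y d : ℝ) :
    HasDerivAt (flowX k x y) (k * flowY k x y d - 1) d := by
  unfold flowX flowY
  split_ifs with hk
  · simpa [hk] using (hasDerivAt_id d).const_sub x
  · have hd := (hasDerivAt_id d).const_mul k
    refine ((hd.cos.const_mul x).add (hd.sin.const_mul (y - 1 / k))).congr_deriv ?_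
    simp only [id]
    field_simp
    ring

theorem hasDerivAt_flowY (k x y d : ℝ) :
    HasDerivAt (flowY k x y) (-(k * flowX k x y d)) d := by
  unfold flowX flowY
  split_ifs with hk
  · simpa [hk] using hasDerivAt_const d y
  · have hd := (hasDerivAt_id d).const_mul k
    refine (((hd.sin.const_mul x).const_sub (1 / k)).add
      (hd.cos.const_mul (y - 1 / k))).congr_deriv ?_
    simp only [id]
    ring

/-- The state reached from `s` with the acceleration `c` after the time `r`. -/
noncomputable def advance (s : State) (c r : ℝ) : State
  | .x => flowX (s .k) (s .x) (s .y) (s .v * r + c / 2 * r ^ 2)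
  | .y => flowY (s .k) (s .x) (s .y) (s .v * r + c / 2 * r ^ 2)
  | .v => s .v + c * r
  | .a => c
  | .t => r
  | .A => s .A
  | .B => s .B
  | .T => s .T
  | .eps => s .eps
  | .vl => s .vl
  | .vh => s .vh
  | .k => s .k

/-- The position depends on time only through the distance travelled, so the chain rule turns the
flow by distance into a solution of the plant. The speed is affine in time, so its signs at the two
ends suffice. -/
theorem plant_run_advance {s : State} {c r : ℝ} (hr : 0 ≤ r) (hrT : r ≤ s .T)
    (hv : 0 ≤ s .v) (hvr : 0 ≤ s .v + c * r) :
    plant.Run (Function.update s .a c) (advance s c r) := by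
  refine ⟨_, rfl, r, hr, advance s c, ?_, rfl, fun τ hτ => ⟨?_, ?_, ?_, ?_⟩⟩
  · funext z
    cases z <;> simp [advance, flowX_zero, flowY_zero]
  · have dd : HasDerivAt (fun u => s .v * u + c / 2 * u ^ 2) (s .v + c * τ) τ := by
      refine (((hasDerivAt_id τ).const_mul (s .v)).add
        (((hasDerivAt_id τ).pow 2).const_mul (c / 2))).congr_deriv ?_
      simp; ring
    intro e he
    simp only [List.mem_cons, List.not_mem_nil, or_false] at he
    rcases he with rfl | rfl | rfl | rfl
    · refine (((hasDerivAt_flowX (s .k) (s .x) (s .y) _).comp τ dd).congr_deriv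
        ?_).hasDerivWithinAt
      simp only [advance]; ring
    · refine (((hasDerivAt_flowY (s .k) (s .x) (s .y) _).comp τ dd).congr_deriv
        ?_).hasDerivWithinAt
      simp only [advance]; ring
    · refine ((((hasDerivAt_id τ).const_mul c).const_add (s .v)).congr_deriv
        ?_).hasDerivWithinAt
      simp [advance]
    · exact (hasDerivAt_id τ).hasDerivWithinAt
  · intro z hz
    cases z <;> simp [advance] at hz ⊢
  · exact hτ.2.trans hrT
  · simp only [advance]
    rcases le_total 0 c with hc | hc
    · have := hτ.1
      positivity
    · nlinarith [hτ.2]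

/-! ### Bringing the speed between its limits -/

/-- The states from which the robot still reaches the waypoint: on a straight line, the waypoint
has to be ahead. -/
def Ready (s : State) : Prop := J s ∧ ParamsPos s ∧ 0 < s .v ∧ (s .k = 0 → 0 < s .x)

/-- The loop of acceleration controller and plant. -/
def Reach : State → State → Prop := (HP.star (.seq ctrlA plant)).Run

theorem reach_advance {s : State} {c r : ℝ} (hG : Go (Function.update s .a c)) (hr : 0 ≤ r)
    (hrT : r ≤ s .T) (hv : 0 ≤ s .v) (hvr : 0 ≤ s .v + c * r) : Reach s (advance s c r) :=
  .single ⟨_, ⟨_, ⟨c, rfl⟩, rfl, hG⟩, plant_run_advance hr hrT hv hvr⟩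

theorem Ready.advance {s : State} (h : Ready s) {c r : ℝ} (hG : Go (Function.update s .a c))
    (hr : 0 ≤ r) (hrT : r ≤ s .T) (hvr : 0 < s .v + c * r)
    (hx : s .k = 0 → s .v * r + c / 2 * r ^ 2 < s .x) : Ready (advance s c r) := by
  obtain ⟨⟨hA, hL, -⟩, hp, hv, -⟩ := h
  have := J_of_plant_run (s := Function.update s .a c) (by simpa [ParamsPos] using hp)
    (by simpa [Ann] using hA) (by simpa [LimitsOk] using hL) hG
    (plant_run_advance hr hrT hv.le hvr.le)
  refine ⟨this.1, this.2, hvr, fun hk => ?_⟩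
  have hk : s .k = 0 := hk
  simpa [Waypoint.advance, flowX, hk] using hx hk

/-- On a straight line, the distance needed to close a speed gap is short of the waypoint. -/
theorem Ready.gap_lt {s : State} (h : Ready s) (hk : s .k = 0) {g : ℝ} (hg : 0 ≤ g)
    (hl : (1 + |s .k| * s .eps) ^ 2 * g + s .eps ≤ maxNorm s) : g < s .x := by
  obtain ⟨⟨⟨-, hA⟩, -⟩, ⟨-, -, -, he⟩, -, hx⟩ := h
  simp [hk, maxNorm] at hA hl
  rw [abs_of_pos (hx hk)] at hl
  -- For `k = 0`, `Ann` says `|y| < ε`, so only `x` can realise the max norm.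
  rcases hl with hl | hl <;> linarith

/-- A robot that is too slow accelerates to the lower speed limit. -/
theorem reach_of_le_vh (n : ℕ) : ∀ s : State, Ready s → s .v ≤ s .vh →
    s .vl - s .v ≤ n * (s .A * s .T) → ∃ s', Reach s s' ∧ Ready s' ∧ s' .vl ≤ s' .v ∧
      s' .v ≤ s' .vh := by
  induction n with
  | zero =>
    intro s h hv hn
    exact ⟨s, .refl, h, by simpa using hn, hv⟩
  | succ n ih =>
    intro s h hv hn
    by_cases hl : s .vl ≤ s .v
    · exact ⟨s, .refl, h, hl, hv⟩
    obtain ⟨⟨hAnn, hL, hlo, hhi⟩, ⟨hA, hB, hT, he⟩, hpos, hx⟩ := id h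
    obtain ⟨hL0, hL1, hL2, hL3⟩ := id hL
    have hgap := hlo.resolve_left hl
    push Not at hl
    have hAT := mul_pos hA hT
    -- `AT ≤ vh - vl` prevents overshooting `vh`. At `a = A`, the distance of one cycle plus the gap
    -- left after it equals the present gap, so `J` gives the lower-limit clause.
    have hG : Go (Function.update s .a (s .A)) := by
      refine ⟨⟨?_, ?_, ?_⟩, .inl ⟨?_, ?_⟩, .inr ?_⟩
      · simp; linarith
      · simp
      · simp; linarith
      · simpa using hv
      · simp; linarith
      · simp only [maxNorm] at hgap ⊢
        simp [-le_sup_iff]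
        refine le_trans (le_of_eq ?_) hgap
        field_simp
        ring
    -- Either a whole cycle, which uses up one unit of `n`, or just long enough to reach `vl`.
    set r := min (s .T) ((s .vl - s .v) / s .A) with hr
    have hr0 : 0 ≤ r := le_min hT.le (div_nonneg (by linarith) hA.le)
    have hrT : r ≤ s .T := min_le_left _ _
    have hAr0 : 0 ≤ s .A * r := by positivity
    have hAr : s .A * r ≤ s .vl - s .v := by
      have := min_le_right (s .T) ((s .vl - s .v) / s .A)
      rw [le_div_iff₀ hA] at this
      linarith
    have hd : s .v * r + s .A / 2 * r ^ 2 ≤ (s .vl ^ 2 - s .v ^ 2) / (2 * s .A) := by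
      rw [le_div_iff₀ (by positivity)]
      nlinarith
    have hready := h.advance hG hr0 hrT (by linarith) fun hk => hd.trans_lt
      (h.gap_lt hk (div_nonneg (by nlinarith) (by positivity)) hgap)
    have hreach := reach_advance hG hr0 hrT hpos.le (by linarith)
    obtain ⟨s', h₁, h₂⟩ := ih _ hready (by simp only [advance]; linarith) (by
      simp only [advance]
      rcases min_choice (s .T) ((s .vl - s .v) / s .A) with hm | hm
      · rw [hr, hm]
        push_cast at hn
        linarith
      · rw [hr, hm, mul_div_cancel₀ _ hA.ne']
        have : 0 ≤ (n : ℝ) * (s .A * s .T) := by positivity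
        linarith)
    exact ⟨s', hreach.trans h₁, h₂⟩

/-- A robot that is too fast brakes to the upper speed limit. -/
theorem reach_of_vl_le (n : ℕ) : ∀ s : State, Ready s → s .vl ≤ s .v →
    s .v - s .vh ≤ n * (s .B * s .T) → ∃ s', Reach s s' ∧ Ready s' ∧ s' .vl ≤ s' .v ∧
      s' .v ≤ s' .vh := by
  induction n with
  | zero =>
    intro s h hv hn
    exact ⟨s, .refl, h, hv, by simpa using hn⟩
  | succ n ih =>
    intro s h hv hn
    by_cases hl : s .v ≤ s .vh
    · exact ⟨s, .refl, h, hv, hl⟩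
    obtain ⟨⟨hAnn, hL, hlo, hhi⟩, ⟨hA, hB, hT, he⟩, hpos, hx⟩ := id h
    obtain ⟨hL0, hL1, hL2, hL3⟩ := id hL
    have hgap := hhi.resolve_left hl
    push Not at hl
    have hBT := mul_pos hB hT
    -- `BT ≤ vh - vl` keeps the speed above `vl` while braking for a whole cycle.
    have hG : Go (Function.update s .a (-s .B)) := by
      refine ⟨⟨?_, ?_, ?_⟩, .inr ?_, .inl ⟨?_, ?_⟩⟩
      · simp
      · simp; linarith
      · simp; linarith
      · simp only [maxNorm] at hgap ⊢
        simp [-le_sup_iff]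
        refine le_trans (le_of_eq ?_) hgap
        field_simp
        ring
      · simpa using hv
      · simp; linarith
    set r := min (s .T) ((s .v - s .vh) / s .B) with hr
    have hr0 : 0 ≤ r := le_min hT.le (div_nonneg (by linarith) hB.le)
    have hrT : r ≤ s .T := min_le_left _ _
    have hBr0 : 0 ≤ s .B * r := by positivity
    have hBr : s .B * r ≤ s .v - s .vh := by
      have := min_le_right (s .T) ((s .v - s .vh) / s .B)
      rw [le_div_iff₀ hB] at this
      linarith
    have hd : s .v * r + -s .B / 2 * r ^ 2 ≤ (s .v ^ 2 - s .vh ^ 2) / (2 * s .B) := by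
      rw [le_div_iff₀ (by positivity)]
      nlinarith
    have hready := h.advance hG hr0 hrT (by linarith) fun hk => hd.trans_lt
      (h.gap_lt hk (div_nonneg (by nlinarith) (by positivity)) hgap)
    have hreach := reach_advance hG hr0 hrT hpos.le (by linarith)
    obtain ⟨s', h₁, h₂⟩ := ih _ hready (by simp only [advance]; linarith) (by
      simp only [advance]
      rcases min_choice (s .T) ((s .v - s .vh) / s .B) with hm | hm
      · rw [hr, hm]
        push_cast at hn
        linarith
      · rw [hr, hm, neg_mul, mul_div_cancel₀ _ hB.ne']
        have : 0 ≤ (n : ℝ) * (s .B * s .T) := by positivity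
        linarith)
    exact ⟨s', hreach.trans h₁, h₂⟩

/-- Every ready robot can bring its speed between the speed limits. -/
theorem Ready.reach_limits {s : State} (h : Ready s) :
    ∃ s', Reach s s' ∧ Ready s' ∧ s' .vl ≤ s' .v ∧ s' .v ≤ s' .vh := by
  obtain ⟨⟨-, hL, -⟩, ⟨hA, hB, hT, -⟩, -⟩ := id h
  rcases le_total (s .v) (s .vh) with hv | hv
  · obtain ⟨n, hn⟩ := exists_nat_ge ((s .vl - s .v) / (s .A * s .T))
    exact reach_of_le_vh n s h hv ((div_le_iff₀ (by positivity)).1 hn)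
  · obtain ⟨n, hn⟩ := exists_nat_ge ((s .v - s .vh) / (s .B * s .T))
    exact reach_of_vl_le n s h (hL.2.1.le.trans hv) ((div_le_iff₀ (by positivity)).1 hn)

/-! ### Reaching the waypoint at constant speed -/

/-- A robot within the speed limits can travel any distance at constant speed. -/
theorem reach_of_dist (n : ℕ) : ∀ (s : State) (d : ℝ), ParamsPos s → 0 < s .v →
    s .vl ≤ s .v → s .v ≤ s .vh → 0 ≤ d → d ≤ n * (s .v * s .T) →
    √(flowX (s .k) (s .x) (s .y) d ^ 2 + flowY (s .k) (s .x) (s .y) d ^ 2) ≤ s .eps →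
    ∃ s', Reach s s' ∧ AtGoal s' := by
  induction n with
  | zero =>
    intro s d _ _ hl hh hd hn hgoal
    obtain rfl : d = 0 := le_antisymm (by simpa using hn) hd
    rw [flowX_zero, flowY_zero] at hgoal
    exact ⟨s, .refl, hgoal, hl, hh⟩
  | succ n ih =>
    intro s d hp hv hl hh hd hn hgoal
    have hT := hp.2.2.1
    have hG : Go (Function.update s .a 0) := by
      refine ⟨⟨?_, ?_, ?_⟩, .inl ⟨?_, ?_⟩, .inl ⟨?_, ?_⟩⟩ <;>
        simp [hl, hh, hv.le, hp.1.le, hp.2.1.le]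
    set r := min (s .T) (d / s .v) with hr
    have hr0 : 0 ≤ r := le_min hT.le (by positivity)
    have hrd : s .v * r ≤ d := by
      have := min_le_right (s .T) (d / s .v)
      rw [le_div_iff₀ hv] at this
      linarith
    have hreach := reach_advance hG hr0 (min_le_left _ _) hv.le (by simpa using hv.le)
    obtain ⟨s', h₁, h₂⟩ := ih (advance s 0 r) (d - s .v * r) hp (by simpa [advance] using hv)
      (by simpa [advance] using hl) (by simpa [advance] using hh) (sub_nonneg.2 hrd)
      (by
        simp only [advance, zero_mul, add_zero]
        rcases min_choice (s .T) (d / s .v) with hm | hm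
        · rw [hr, hm]
          push_cast at hn
          linarith
        · rw [hr, hm, mul_div_cancel₀ _ hv.ne', sub_self]
          positivity)
      (by
        simp only [advance, zero_div, zero_mul, add_zero]
        rwa [flowX_add, flowY_add, add_sub_cancel])
    exact ⟨s', hreach.trans h₁, h₂⟩

/-- A rotation takes `(x, y)` to the point `(0, ±ρ)` of the same circle. -/
theorem exists_rotation {x y ρ : ℝ} (hρ : ρ ≠ 0) (h : x ^ 2 + y ^ 2 = ρ ^ 2) :
    ∃ θ : ℝ, x * Real.cos θ + y * Real.sin θ = 0 ∧ -x * Real.sin θ + y * Real.cos θ = ρ := by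
  -- The angle sought has cosine `y / ρ` and sine `-x / ρ`.
  have hz : (⟨y / ρ, -x / ρ⟩ : ℂ) ≠ 0 := by
    intro h0
    have h₁ := congrArg Complex.re h0
    have h₂ := congrArg Complex.im h0
    simp [hρ] at h₁ h₂
    exact hρ (by simpa [h₁, h₂] using h.symm)
  have hnorm : ‖(⟨y / ρ, -x / ρ⟩ : ℂ)‖ = 1 := by
    rw [Complex.norm_eq_sqrt_sq_add_sq, Real.sqrt_eq_one]
    field_simp
    linarith
  refine ⟨Complex.arg ⟨y / ρ, -x / ρ⟩, ?_, ?_⟩ <;>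
    rw [Complex.cos_arg hz, Complex.sin_arg, hnorm] <;> field_simp
  · ring
  · linarith

/-- The path of the robot passes within distance `ε` of the waypoint. -/
theorem Ready.exists_dist {s : State} (h : Ready s) : ∃ d, 0 ≤ d ∧
    √(flowX (s .k) (s .x) (s .y) d ^ 2 + flowY (s .k) (s .x) (s .y) d ^ 2) ≤ s .eps := by
  obtain ⟨⟨⟨hke, hA⟩, -⟩, ⟨-, -, -, he⟩, -, hx⟩ := h
  by_cases hk : s .k = 0
  · refine ⟨s .x, (hx hk).le, ?_⟩
    simp [hk] at hA
    simpa [flowX, flowY, hk, Real.sqrt_sq_eq_abs] using hA.le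
  · have hk0 := abs_pos.2 hk
    set u := s .k * (s .x ^ 2 + s .y ^ 2 - s .eps ^ 2) / 2 - s .y with hu
    have hku : |s .k * u| < |s .k| * s .eps := by
      rw [abs_mul]
      exact mul_lt_mul_of_pos_left hA hk0
    obtain ⟨hku₁, hku₂⟩ := abs_lt.1 hku
    have hsq := sq_add_sq_eq (s .k) (s .eps) (s .x) (s .y)
    rw [← hu] at hsq
    set R := √((s .k * s .x) ^ 2 + (s .k * s .y - 1) ^ 2) with hR
    have hR2 : R ^ 2 = (s .k * s .x) ^ 2 + (s .k * s .y - 1) ^ 2 := Real.sq_sqrt (by positivity)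
    have hks : (s .k * s .eps) ^ 2 = (|s .k| * s .eps) ^ 2 := by
      rw [mul_pow, mul_pow, sq_abs]
    have hRlt : R < 1 + |s .k| * s .eps := lt_of_pow_lt_pow_left₀ 2 (by positivity) (by nlinarith)
    have hRgt : 1 - |s .k| * s .eps < R :=
      lt_of_pow_lt_pow_left₀ 2 (Real.sqrt_nonneg _) (by nlinarith)
    have hRpos : 0 < R := by linarith
    -- The sign of `ρ` selects `(0, (1 - R) / k)`, the point of the circle nearest the origin.
    obtain ⟨θ, hθ₁, hθ₂⟩ := exists_rotation (x := s .x) (y := s .y - 1 / s .k) (ρ := -R / s .k)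
      (div_ne_zero (neg_ne_zero.2 hRpos.ne') hk) (by
        rw [div_pow, neg_sq, hR2]
        field_simp)
    obtain ⟨d, hd, hcos, hsin⟩ : ∃ d, 0 ≤ d ∧ Real.cos (s .k * d) = Real.cos θ ∧
        Real.sin (s .k * d) = Real.sin θ := by
      -- Full turns of length `2π / |k|` are added to make the distance nonnegative; the sign of `k`
      -- decides their direction in `θ`.
      obtain ⟨m, hm⟩ := exists_nat_ge (-(θ / s .k) / (2 * Real.pi / |s .k|))
      rw [div_le_iff₀ (by positivity)] at hm
      rcases abs_choice (s .k) with hs | hs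
      · refine ⟨θ / s .k + m * (2 * Real.pi / |s .k|), by linarith, ?_⟩
        have : s .k * (θ / s .k + m * (2 * Real.pi / |s .k|)) = θ + m * (2 * Real.pi) := by
          rw [hs]; field_simp
        rw [this]
        exact ⟨Real.cos_add_nat_mul_two_pi θ m, Real.sin_add_nat_mul_two_pi θ m⟩
      · refine ⟨θ / s .k + m * (2 * Real.pi / |s .k|), by linarith, ?_⟩
        have : s .k * (θ / s .k + m * (2 * Real.pi / |s .k|)) = θ - m * (2 * Real.pi) := by
          rw [hs]; field_simp; ring
        rw [this]
        exact ⟨Real.cos_sub_nat_mul_two_pi θ m, Real.sin_sub_nat_mul_two_pi θ m⟩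
    refine ⟨d, hd, ?_⟩
    have hX : flowX (s .k) (s .x) (s .y) d = 0 := by
      simp only [flowX, if_neg hk, hcos, hsin, hθ₁]
    have hY : flowY (s .k) (s .x) (s .y) d = (1 - R) / s .k := by
      simp only [flowY, if_neg hk, hcos, hsin]
      rw [sub_div, sub_eq_add_neg (1 / s .k) (R / s .k), ← neg_div, ← hθ₂]
      ring
    rw [hX, hY, zero_pow two_ne_zero, zero_add, Real.sqrt_sq_eq_abs, abs_div, div_le_iff₀ hk0]
    exact abs_le.2 ⟨by linarith, by linarith⟩

/-- Every ready robot can reach the waypoint within the speed limits. -/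
theorem Ready.reach_goal {s : State} (h : Ready s) : ∃ s', Reach s s' ∧ AtGoal s' := by
  obtain ⟨u, hsu, hu, hl, hh⟩ := h.reach_limits
  obtain ⟨d, hd, hgoal⟩ := hu.exists_dist
  have hvT : 0 < u .v * u .T := mul_pos hu.2.2.1 hu.2.1.2.2.1
  obtain ⟨n, hn⟩ := exists_nat_ge (d / (u .v * u .T))
  obtain ⟨s', hus', hs'⟩ := reach_of_dist n u d hu.2.1 hu.2.2.1 hl hh hd
    ((div_le_iff₀ hvT).1 hn) hgoal
  exact ⟨s', hsu.trans hus', hs'⟩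

end Waypoint

theorem theorem2 :
    Waypoint.Valid fun s =>
      0 < s .A ∧ 0 < s .B ∧ 0 < s .T ∧ 0 < s .eps ∧ Waypoint.J s →
        Waypoint.box (.star (.seq Waypoint.ctrl Waypoint.plant))
          (fun s => 0 < s .v ∧ 0 < s .x →
            Waypoint.diamond (.star (.seq Waypoint.ctrlA Waypoint.plant)) Waypoint.AtGoal s) s := by
  rintro s ⟨hA, hB, hT, he, hJ⟩ u hu ⟨hv, hx⟩
  obtain ⟨hJu, hp⟩ := Waypoint.J_of_loop_run ⟨hA, hB, hT, he⟩ hJ hu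
  exact Waypoint.Ready.reach_goal ⟨hJu, hp, hv, fun _ => hx⟩
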